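/- Let $p$ be an odd prime, let $e \ge 1$ be an integer, and let $q = p^e$. A polynomial $h \in \mathbb{F}_q[X]$ is called a permutation polynomial of $\mathbb{F}_q$ if the map $x \mapsto h(x)$ is a permutation of $\mathbb{F}_q$. For an integer $k$ with $1 \le k \le q-1$, let $$A_k = X^k\bigl[(X+1)^k - X^k\bigr] \in \mathbb{F}_q[X].$$ Then $A_k$ is a permutation polynomial of $\mathbb{F}_q$ if and only if $k$ is a power of $p$ (that is, $k = p^i$ for some integer $i \ge 0$). -/

import Mathlib

open Polynomial

/-- A polynomial `h` over a field `F` is a permutation polynomial of `F` if the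
evaluation map `x ↦ h(x)` is a permutation of `F`. -/
def IsPermutationPolynomial {F : Type*} [Field F] (h : F[X]) : Prop :=
  Function.Bijective fun x : F => h.eval x

/-- The polynomial `A_k = X^k [(X + 1)^k - X^k]` in `F[X]`. -/
noncomputable def polyA (F : Type*) [Field F] (k : ℕ) : F[X] :=
  X ^ k * ((X + 1) ^ k - X ^ k)

/-! If k = p^i, then A_k = X^k is a power of Frobenius, hence bijective. For the converse, put Q = q
- 1. A permuting A_k forces gcd(k, Q) = 1; let m be the inverse of k mod Q. The substitution x =
1/((1+z)^m - 1) turns the vanishing of the power sum of A_k^L, with L ≡ -mt mod Q, into ∑ ((1+z)^m -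
1)^(2t) z^L = 0. For t = a + p^j b with 2a, 2b < p, the left side expands into binomials C(ms, mt),
exponents reduced to [1, Q] and s = i₀ + p^j i₁. The middle term s = t is nonzero, so another
binomial is nonzero mod p (`exists_not_dvd_choose_cyclicRep`).

Let w be the digit sum of the representative in [1, Q]. It is subadditive, and w(ms) ≤ (i₀ + i₁)
w(m). By Kummer's theorem, if t attains this bound then so does the other surviving s, with i₀ + i₁
≥ a + b (`exists_le_cyclicWeight_mul`).

With b = 0 this shows that some n > p/2 attains the bound, so multiplying m by n makes no carry and
the digits of m are 0 or 1. If two digits at distance j were 1, then a = b = (p-1)/2 and Lucas'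
theorem would make the digits invariant under the shift by j, so p^j ≡ 1 mod Q, which is absurd.
Hence m, and with it k, is a power of p. -/

/-- The sum of the base-`p` digits of `x`. -/
def digitSum (p x : ℕ) : ℕ := (Nat.digits p x).sum

theorem digitSum_le (p x : ℕ) : digitSum p x ≤ x := Nat.digit_sum_le p x

/-! ### Digit sums and carries -/

section DigitSum

variable {p : ℕ} [hp : Fact p.Prime]

theorem digitSum_add_mul {x : ℕ} (hx : x < p) (y : ℕ) :
    digitSum p (x + p * y) = x + digitSum p y := by
  by_cases h : x ≠ 0 ∨ y ≠ 0
  · simp [digitSum, Nat.digits_add p hp.out.one_lt x y hx h]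
  · push Not at h
    simp [digitSum, h.1, h.2]

theorem digitSum_of_lt {x : ℕ} (hx : x < p) : digitSum p x = x := by
  simpa [digitSum] using digitSum_add_mul hx 0

theorem digitSum_pow_mul_add (e a : ℕ) {b : ℕ} (hb : b < p ^ e) :
    digitSum p (p ^ e * a + b) = digitSum p a + digitSum p b := by
  induction e generalizing b with
  | zero =>
    obtain rfl : b = 0 := by simpa using hb
    simp [digitSum]
  | succ e ih =>
    have hlt : b % p < p := Nat.mod_lt _ hp.out.pos
    have hdiv : b / p < p ^ e := Nat.div_lt_of_lt_mul (by rwa [pow_succ'] at hb)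
    have h1 : p ^ (e + 1) * a + b = b % p + p * (p ^ e * a + b / p) := by
      conv_lhs => rw [← Nat.mod_add_div b p]
      ring
    rw [h1, digitSum_add_mul hlt, ih hdiv]
    conv_rhs => rw [← Nat.mod_add_div b p, digitSum_add_mul hlt]
    ring

theorem add_digitSum_eq (n : ℕ) :
    (p - 1) * padicValNat p n.factorial + digitSum p n = n := by
  rw [sub_one_mul_padicValNat_factorial]
  exact Nat.sub_add_cancel (digitSum_le p n)

/-- Kummer's theorem in digit-sum form, from Legendre's formula for the three factorials: each carry
costs p - 1. -/
theorem digitSum_add_choose (x y : ℕ) :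
    (p - 1) * padicValNat p ((x + y).choose x) + digitSum p (x + y) =
      digitSum p x + digitSum p y := by
  have hf : padicValNat p (x + y).factorial = padicValNat p ((x + y).choose x) +
      padicValNat p x.factorial + padicValNat p y.factorial := by
    have hfac := Nat.choose_mul_factorial_mul_factorial (Nat.le_add_right x y)
    rw [Nat.add_sub_cancel_left] at hfac
    rw [← hfac,
      padicValNat.mul (Nat.mul_ne_zero (Nat.choose_pos (Nat.le_add_right x y)).ne'
        x.factorial_ne_zero) y.factorial_ne_zero,
      padicValNat.mul (Nat.choose_pos (Nat.le_add_right x y)).ne' x.factorial_ne_zero]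
  have h1 := add_digitSum_eq (p := p) (x + y)
  have h2 := add_digitSum_eq (p := p) x
  have h3 := add_digitSum_eq (p := p) y
  rw [hf, mul_add, mul_add] at h1
  lia

theorem digitSum_add_le (x y : ℕ) :
    digitSum p (x + y) ≤ digitSum p x + digitSum p y := by
  have := digitSum_add_choose (p := p) x y
  lia

theorem digitSum_eq_of_not_dvd_choose {n h : ℕ} (hc : ¬ p ∣ n.choose h) :
    h ≤ n ∧ digitSum p n = digitSum p h + digitSum p (n - h) := by
  have hle : h ≤ n := by
    by_contra hlt
    exact hc (by simp [Nat.choose_eq_zero_of_lt (not_le.mp hlt)])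
  refine ⟨hle, ?_⟩
  have := digitSum_add_choose (p := p) h (n - h)
  rw [Nat.add_sub_cancel' hle, padicValNat.eq_zero_of_not_dvd hc] at this
  lia

theorem digitSum_pow (a : ℕ) : digitSum p (p ^ a) = 1 := by
  have h1 : digitSum p 1 = 1 := digitSum_of_lt hp.out.one_lt
  have h0 : digitSum p 0 = 0 := by simp [digitSum]
  simpa [h1, h0] using digitSum_pow_mul_add (p := p) a 1 (b := 0) (pow_pos hp.out.pos a)

theorem digitSum_pos {x : ℕ} (hx : 0 < x) : 0 < digitSum p x := by
  induction x using Nat.strong_induction_on with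
  | _ x ih =>
    rw [← Nat.mod_add_div x p, digitSum_add_mul (Nat.mod_lt _ hp.out.pos)]
    rcases Nat.eq_zero_or_pos (x % p) with h | h
    · have hd : 0 < x / p := Nat.div_pos (Nat.le_of_dvd hx (Nat.dvd_of_mod_eq_zero h)) hp.out.pos
      have := ih _ (Nat.div_lt_self hx hp.out.one_lt) hd
      lia
    · lia

theorem digitSum_lt_self {x : ℕ} (hx : p ≤ x) : digitSum p x < x := by
  have h1 : digitSum p x ≤ digitSum p p + digitSum p (x - p) := by
    simpa [Nat.add_sub_cancel' hx] using digitSum_add_le (p := p) p (x - p)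
  have h2 : digitSum p p = 1 := by simpa using digitSum_pow (p := p) 1
  have h3 := digitSum_le p (x - p)
  have := hp.out.two_le
  lia

end DigitSum

/-! ### Representatives and weights modulo p^e - 1 -/

/-- The representative of `x` modulo `Q` in the interval `[1, Q]`. -/
def cyclicRep (Q x : ℕ) : ℕ := if x % Q = 0 then Q else x % Q

section CyclicRep

variable {Q : ℕ}

theorem cyclicRep_modEq (Q x : ℕ) : cyclicRep Q x ≡ x [MOD Q] := by
  unfold cyclicRep
  split_ifs with h
  · simp [Nat.ModEq, h]
  · exact Nat.mod_modEq x Q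

theorem cyclicRep_congr {x y : ℕ} (h : x ≡ y [MOD Q]) : cyclicRep Q x = cyclicRep Q y := by
  unfold cyclicRep
  rw [show x % Q = y % Q from h]

theorem cyclicRep_pos (hQ : 0 < Q) (x : ℕ) : 0 < cyclicRep Q x := by
  unfold cyclicRep
  split_ifs with h <;> lia

theorem cyclicRep_le (hQ : 0 < Q) (x : ℕ) : cyclicRep Q x ≤ Q := by
  unfold cyclicRep
  split_ifs with h
  · exact le_rfl
  · exact (Nat.mod_lt x hQ).le

theorem cyclicRep_eq_self {x : ℕ} (h0 : 0 < x) (hx : x ≤ Q) : cyclicRep Q x = x := by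
  unfold cyclicRep
  rcases hx.eq_or_lt with rfl | h
  · simp
  · rw [Nat.mod_eq_of_lt h, if_neg h0.ne']

end CyclicRep

/-- The base-`p` digit sum of the representative of `x` modulo `p ^ e - 1` in `[1, p ^ e - 1]`. -/
def cyclicWeight (p e x : ℕ) : ℕ := digitSum p (cyclicRep (p ^ e - 1) x)

theorem cyclicWeight_congr {p e x y : ℕ} (h : x ≡ y [MOD p ^ e - 1]) :
    cyclicWeight p e x = cyclicWeight p e y := by
  rw [cyclicWeight, cyclicRep_congr h, cyclicWeight]

section CyclicWeight

variable {p e : ℕ} [hp : Fact p.Prime]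

theorem pow_sub_one_pos (he : 0 < e) : 0 < p ^ e - 1 :=
  Nat.sub_pos_of_lt (Nat.one_lt_pow he.ne' hp.out.one_lt)

/-- Folding p^e * a + b into a + b preserves the class mod p^e - 1, stays positive and does not
increase the digit sum; repeat until the number is at most p^e - 1. -/
theorem cyclicWeight_le_digitSum (he : 0 < e) {x : ℕ} (hx : 0 < x) :
    cyclicWeight p e x ≤ digitSum p x := by
  have hQ := pow_sub_one_pos (p := p) he
  induction x using Nat.strong_induction_on with
  | _ x ih =>
    rcases le_or_gt x (p ^ e - 1) with hle | hlt
    · rw [cyclicWeight, cyclicRep_eq_self hx hle]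
    · have hpe : 0 < p ^ e := pow_pos hp.out.pos e
      have hge : p ^ e ≤ x := by lia
      have hb : x % p ^ e < p ^ e := Nat.mod_lt _ hpe
      have ha : 0 < x / p ^ e := Nat.div_pos hge hpe
      have hx' := Nat.div_add_mod x (p ^ e)
      have hsplit : p ^ e * (x / p ^ e) = (p ^ e - 1) * (x / p ^ e) + x / p ^ e := by
        conv_lhs => rw [show p ^ e = p ^ e - 1 + 1 by lia]
        conv_rhs => rw [show p ^ e = p ^ e - 1 + 1 by lia]
        rw [Nat.add_sub_cancel]
        ring
      have hmul : 0 < (p ^ e - 1) * (x / p ^ e) := Nat.mul_pos hQ ha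
      have hlt' : x / p ^ e + x % p ^ e < x := by lia
      have hmod : x / p ^ e + x % p ^ e ≡ x [MOD p ^ e - 1] := by
        conv_rhs => rw [← hx', hsplit, add_assoc]
        simp [Nat.ModEq]
      calc cyclicWeight p e x = cyclicWeight p e (x / p ^ e + x % p ^ e) :=
            cyclicWeight_congr hmod.symm
        _ ≤ digitSum p (x / p ^ e + x % p ^ e) := ih _ hlt' (by lia)
        _ ≤ digitSum p (x / p ^ e) + digitSum p (x % p ^ e) := digitSum_add_le _ _
        _ = digitSum p x := by rw [← digitSum_pow_mul_add e _ hb, hx']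

theorem cyclicWeight_add_le (he : 0 < e) (x y : ℕ) :
    cyclicWeight p e (x + y) ≤ cyclicWeight p e x + cyclicWeight p e y := by
  have hQ := pow_sub_one_pos (p := p) he
  rw [cyclicWeight_congr ((cyclicRep_modEq _ x).add (cyclicRep_modEq _ y)).symm]
  exact (cyclicWeight_le_digitSum he (Nat.add_pos_left (cyclicRep_pos hQ x) _)).trans
    (digitSum_add_le _ _)

theorem cyclicWeight_pos (he : 0 < e) (x : ℕ) : 0 < cyclicWeight p e x :=
  digitSum_pos (cyclicRep_pos (pow_sub_one_pos he) x)

theorem cyclicWeight_pow_mul_le (he : 0 < e) (j x : ℕ) :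
    cyclicWeight p e (p ^ j * x) ≤ cyclicWeight p e x := by
  have hQ := pow_sub_one_pos (p := p) he
  have hpos := cyclicRep_pos hQ x
  rw [cyclicWeight_congr ((cyclicRep_modEq _ x).symm.mul_left (p ^ j))]
  refine (cyclicWeight_le_digitSum he (Nat.mul_pos (pow_pos hp.out.pos j) hpos)).trans ?_
  have h := digitSum_pow_mul_add (p := p) j (cyclicRep (p ^ e - 1) x) (b := 0)
    (pow_pos hp.out.pos j)
  rw [add_zero] at h
  simp [cyclicWeight, h, show digitSum p 0 = 0 by simp [digitSum]]

theorem cyclicWeight_mul_le (he : 0 < e) {n : ℕ} (hn : 0 < n) (x : ℕ) :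
    cyclicWeight p e (n * x) ≤ n * cyclicWeight p e x := by
  induction n, hn using Nat.le_induction with
  | base => simp
  | succ n hn ih =>
    rw [add_mul, add_mul, one_mul, one_mul]
    exact (cyclicWeight_add_le he _ _).trans (Nat.add_le_add_right ih _)

/-- If the binomial coefficient of the representatives of `N` and `H` is prime to `p`, then the
weight of `N` is at least the sum of those of `H` and `N - H`. The latter is bounded from below
through any `D` congruent to `2 * H - N`. -/
theorem cyclicWeight_le_of_not_dvd_choose (he : 0 < e) {N H D c : ℕ}
    (hc : ¬ p ∣ (cyclicRep (p ^ e - 1) N).choose (cyclicRep (p ^ e - 1) H))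
    (hne : ¬ N ≡ H [MOD p ^ e - 1]) (hD : N + D ≡ 2 * H [MOD p ^ e - 1])
    (hDc : D = 0 ∨ cyclicWeight p e D ≤ c) :
    cyclicWeight p e H ≤ cyclicWeight p e N ∧
      2 * cyclicWeight p e H ≤ cyclicWeight p e N + c := by
  obtain ⟨hle, heq⟩ := digitSum_eq_of_not_dvd_choose hc
  have hN := cyclicRep_modEq (p ^ e - 1) N
  have hH := cyclicRep_modEq (p ^ e - 1) H
  set z := cyclicRep (p ^ e - 1) N - cyclicRep (p ^ e - 1) H with hz
  have hzN : z + H ≡ N [MOD p ^ e - 1] := by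
    refine (hH.symm.add_left z).trans ?_
    rwa [hz, Nat.sub_add_cancel hle]
  have hz0 : 0 < z := by
    refine Nat.pos_of_ne_zero fun h0 => hne ?_
    rw [h0, zero_add] at hzN
    exact hzN.symm
  have hzw := cyclicWeight_le_digitSum (p := p) he hz0
  have hw : cyclicWeight p e H + cyclicWeight p e z ≤ cyclicWeight p e N := by
    rw [cyclicWeight, cyclicWeight.eq_1 p e N]
    lia
  have hzD : z + D ≡ H [MOD p ^ e - 1] := by
    refine Nat.ModEq.add_right_cancel' H ?_
    rw [add_right_comm, ← two_mul]
    exact (hzN.add_right D).trans hD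
  -- The case D = 0 is separate because the weight of 0 is the digit sum of p^e - 1, not 0.
  have hzH : cyclicWeight p e H ≤ cyclicWeight p e z + c := by
    rcases hDc with rfl | hDc
    · rw [← cyclicWeight_congr hzD, add_zero]
      exact Nat.le_add_right _ _
    · rw [← cyclicWeight_congr hzD]
      exact (cyclicWeight_add_le he z D).trans (Nat.add_le_add_left hDc _)
  lia

end CyclicWeight

/-! ### Digit expansions, Lucas' theorem and cyclic shifts -/

/-- The natural number with base-`p` digits `c`. -/
def digitVal (p : ℕ) {n : ℕ} (c : Fin n → ℕ) : ℕ := ∑ i, c i * p ^ (i : ℕ)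

theorem digitVal_succ (p : ℕ) {n : ℕ} (c : Fin (n + 1) → ℕ) :
    digitVal p c = c 0 + p * digitVal p (Fin.tail c) := by
  simp only [digitVal, Fin.sum_univ_succ, Fin.tail, Finset.mul_sum, Fin.val_zero, pow_zero,
    mul_one, Fin.val_succ]
  congr 1
  exact Finset.sum_congr rfl fun i _ => by ring

theorem digitVal_lt {p n : ℕ} (c : Fin n → ℕ) (hc : ∀ i, c i < p) : digitVal p c < p ^ n := by
  induction n with
  | zero => simp [digitVal]
  | succ n ih =>
    have h1 := ih (Fin.tail c) fun i => hc i.succ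
    have h2 := hc 0
    rw [digitVal_succ, pow_succ']
    calc c 0 + p * digitVal p (Fin.tail c) < p + p * digitVal p (Fin.tail c) := by lia
      _ = p * (digitVal p (Fin.tail c) + 1) := by ring
      _ ≤ p * p ^ n := Nat.mul_le_mul_left _ h1

section DigitVal

variable {p : ℕ} [hp : Fact p.Prime]

theorem digitSum_digitVal {n : ℕ} (c : Fin n → ℕ) (hc : ∀ i, c i < p) :
    digitSum p (digitVal p c) = ∑ i, c i := by
  induction n with
  | zero => simp [digitVal, digitSum]
  | succ n ih =>
    rw [digitVal_succ, digitSum_add_mul (hc 0), ih (Fin.tail c) fun i => hc i.succ,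
      Fin.sum_univ_succ]
    rfl

theorem exists_digitVal_eq (n : ℕ) {x : ℕ} (hx : x < p ^ n) :
    ∃ c : Fin n → ℕ, (∀ i, c i < p) ∧ digitVal p c = x := by
  induction n generalizing x with
  | zero =>
    obtain rfl : x = 0 := by simpa using hx
    exact ⟨Fin.elim0, fun i => i.elim0, by simp [digitVal]⟩
  | succ n ih =>
    obtain ⟨c, hc, hcx⟩ := ih (x := x / p) (Nat.div_lt_of_lt_mul (by rwa [pow_succ'] at hx))
    refine ⟨Fin.cons (x % p) c, Fin.cases (Nat.mod_lt _ hp.out.pos) hc, ?_⟩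
    rw [digitVal_succ, Fin.tail_cons, Fin.cons_zero, hcx, Nat.mod_add_div]

theorem digitSum_sum_le {ι : Type*} (s : Finset ι) (f : ι → ℕ) :
    digitSum p (∑ i ∈ s, f i) ≤ ∑ i ∈ s, digitSum p (f i) :=
  Finset.le_sum_of_subadditive (digitSum p) (by simp [digitSum]) digitSum_add_le s f

/-- A coefficient that is at least p forces a carry, which strictly lowers the digit sum. -/
theorem digitSum_digitVal_lt {n : ℕ} (c : Fin n → ℕ) {i : Fin n} (hi : p ≤ c i) :
    digitSum p (digitVal p c) < ∑ i, c i := by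
  have hmul (x a : ℕ) : digitSum p (x * p ^ a) = digitSum p x := by
    have h := digitSum_pow_mul_add (p := p) a x (b := 0) (pow_pos hp.out.pos a)
    rw [add_zero, mul_comm] at h
    simp [h, show digitSum p 0 = 0 by simp [digitSum]]
  calc digitSum p (digitVal p c) ≤ ∑ i, digitSum p (c i * p ^ (i : ℕ)) := digitSum_sum_le _ _
    _ = ∑ i, digitSum p (c i) := by simp_rw [hmul]
    _ < ∑ i, c i := Finset.sum_lt_sum (fun i _ => digitSum_le p _)
      ⟨i, Finset.mem_univ i, digitSum_lt_self hi⟩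

theorem le_of_not_dvd_choose_digitVal {n : ℕ} (c d : Fin n → ℕ) (hc : ∀ i, c i < p)
    (hd : ∀ i, d i < p) (h : ¬ p ∣ (digitVal p c).choose (digitVal p d)) (i : Fin n) :
    d i ≤ c i := by
  induction n with
  | zero => exact i.elim0
  | succ n ih =>
    rw [(Choose.choose_modEq_choose_mod_mul_choose_div_nat (p := p)).dvd_iff dvd_rfl,
      digitVal_succ, digitVal_succ, Nat.add_mul_mod_self_left, Nat.add_mul_mod_self_left,
      Nat.mod_eq_of_lt (hc 0), Nat.mod_eq_of_lt (hd 0), Nat.add_mul_div_left _ _ hp.out.pos,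
      Nat.add_mul_div_left _ _ hp.out.pos, Nat.div_eq_of_lt (hc 0), Nat.div_eq_of_lt (hd 0),
      zero_add, zero_add] at h
    refine Fin.cases ?_ (fun i => ?_) i
    · by_contra hlt
      exact h (by simp [Nat.choose_eq_zero_of_lt (not_le.mp hlt)])
    · exact ih (Fin.tail c) (Fin.tail d) (fun i => hc i.succ) (fun i => hd i.succ)
        (fun hdvd => h (hdvd.mul_left _)) i

/-- Cyclically shifting the digits multiplies by a power of `p` modulo `p ^ (n + 1) - 1`. -/
theorem digitVal_shift_modEq {n : ℕ} (c : Fin (n + 1) → ℕ) (j : Fin (n + 1)) :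
    digitVal p (fun i => c (i - j)) ≡ p ^ (j : ℕ) * digitVal p c [MOD p ^ (n + 1) - 1] := by
  have hone : p ^ (n + 1) ≡ 1 [MOD p ^ (n + 1) - 1] :=
    ((Nat.modEq_iff_dvd' (Nat.one_le_pow _ _ hp.out.pos)).2 dvd_rfl).symm
  have hmod (x : ℕ) : p ^ (x % (n + 1)) ≡ p ^ x [MOD p ^ (n + 1) - 1] := by
    conv_rhs => rw [← Nat.mod_add_div x (n + 1), pow_add, pow_mul]
    simpa using ((hone.pow (x / (n + 1))).mul_left (p ^ (x % (n + 1)))).symm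
  have hsum : digitVal p (fun i => c (i - j)) =
      ∑ i : Fin (n + 1), c i * p ^ (((i : ℕ) + j) % (n + 1)) := by
    rw [digitVal, ← Equiv.sum_comp (Equiv.addRight j)]
    simp [Fin.val_add]
  rw [hsum, digitVal, Finset.mul_sum]
  refine Nat.ModEq.sum fun i _ => ?_
  rw [show p ^ (j : ℕ) * (c i * p ^ (i : ℕ)) = c i * p ^ ((i : ℕ) + j) by ring]
  exact (hmod (i + j)).mul_left (c i)

end DigitVal

/-! ### Power sums over a finite field -/

section PowerSums

variable {F : Type*} [Field F] [Fintype F]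

theorem FiniteField.pow_eq_pow_of_modEq (x : F) {a b : ℕ} (ha : 0 < a) (hb : 0 < b)
    (h : a ≡ b [MOD Fintype.card F - 1]) : x ^ a = x ^ b := by
  rcases eq_or_ne x 0 with rfl | hx
  · rw [zero_pow ha.ne', zero_pow hb.ne']
  · have h1 := FiniteField.pow_card_sub_one_eq_one x hx
    rw [pow_eq_pow_mod a h1, pow_eq_pow_mod b h1, h]

theorem FiniteField.card_sub_one_pos : 0 < Fintype.card F - 1 :=
  Nat.sub_pos_of_lt Fintype.one_lt_card

theorem FiniteField.sum_pow_eq_ite {n : ℕ} (hn : 0 < n) :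
    ∑ x : F, x ^ n = if Fintype.card F - 1 ∣ n then -1 else 0 := by
  classical
  have hQ := FiniteField.card_sub_one_pos (F := F)
  split_ifs with h
  · have hx (x : F) : x ^ n = 1 - if x = 0 then 1 else 0 := by
      split_ifs with h0
      · simp [h0, hn.ne']
      · obtain ⟨c, rfl⟩ := h
        rw [pow_mul, FiniteField.pow_card_sub_one_eq_one x h0, one_pow, sub_zero]
    simp [hx]
  · have hpos : 0 < n % (Fintype.card F - 1) :=
      Nat.pos_of_ne_zero fun h0 => h (Nat.dvd_of_mod_eq_zero h0)
    rw [← FiniteField.sum_pow_lt_card_sub_one F _ (Nat.mod_lt n hQ)]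
    exact Finset.sum_congr rfl fun x _ =>
      FiniteField.pow_eq_pow_of_modEq x hn hpos (Nat.mod_modEq _ _).symm

/-- After reducing N to [1, Q] and expanding, only exponents h + L divisible by Q contribute. This
means h ≡ T, and as T is not 0 mod Q, the only such h in [0, Q] is the representative of T. -/
theorem sum_one_add_pow_mul_pow {N L T : ℕ} (hN : 0 < N) (hL : 0 < L)
    (hT : ¬ Fintype.card F - 1 ∣ T) (hTL : Fintype.card F - 1 ∣ T + L) :
    ∑ z : F, (1 + z) ^ N * z ^ L =
      -(((cyclicRep (Fintype.card F - 1) N).choose (cyclicRep (Fintype.card F - 1) T) : ℕ) : F) := by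
  classical
  have hQ := FiniteField.card_sub_one_pos (F := F)
  set Q := Fintype.card F - 1 with hQdef
  set R := cyclicRep Q N
  have hR : R ≤ Q := cyclicRep_le hQ N
  set S := cyclicRep Q T with hS
  have hST : S ≡ T [MOD Q] := cyclicRep_modEq Q T
  have hexp (z : F) : (1 + z) ^ N * z ^ L =
      ∑ h ∈ Finset.range (R + 1), (R.choose h : F) * z ^ (h + L) := by
    rw [FiniteField.pow_eq_pow_of_modEq (1 + z) hN (cyclicRep_pos hQ N)
      (cyclicRep_modEq Q N).symm, add_comm, add_pow, Finset.sum_mul]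
    exact Finset.sum_congr rfl fun h _ => by rw [one_pow, pow_add]; ring
  have hiff {h : ℕ} (hh : h ∈ Finset.range (R + 1)) : Q ∣ h + L ↔ h = S := by
    have hhQ : h ≤ Q := (Nat.lt_succ_iff.mp (Finset.mem_range.mp hh)).trans hR
    constructor
    · intro hd
      have hmod : h ≡ T [MOD Q] := by
        refine Nat.ModEq.add_right_cancel' L ?_
        exact ((Nat.modEq_zero_iff_dvd).2 hd).trans ((Nat.modEq_zero_iff_dvd).2 hTL).symm
      have h0 : 0 < h := by
        refine Nat.pos_of_ne_zero ?_
        rintro rfl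
        exact hT ((Nat.modEq_zero_iff_dvd).1 hmod.symm)
      rw [hS, ← cyclicRep_congr hmod, cyclicRep_eq_self h0 hhQ]
    · rintro rfl
      exact (Nat.modEq_zero_iff_dvd).1 ((hST.add_right L).trans ((Nat.modEq_zero_iff_dvd).2 hTL))
  simp_rw [hexp]
  rw [Finset.sum_comm]
  simp_rw [← Finset.mul_sum]
  have hterm : ∀ h ∈ Finset.range (R + 1), (R.choose h : F) * ∑ z : F, z ^ (h + L) =
      if h = S then -(R.choose S : F) else 0 := by
    intro h hh
    rw [FiniteField.sum_pow_eq_ite (Nat.add_pos_right h hL), if_congr (hiff hh) rfl rfl]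
    split_ifs with he
    · rw [he, mul_neg_one]
    · rw [mul_zero]
  rw [Finset.sum_congr rfl hterm, Finset.sum_ite_eq']
  split_ifs with hmem
  · rfl
  · rw [Nat.choose_eq_zero_of_lt (by simpa using hmem)]
    simp

end PowerSums

/-! ### Consequences of the permutation property -/

section PolyA

variable {F : Type*} [Field F]

theorem polyA_eval (k : ℕ) (x : F) : (polyA F k).eval x = x ^ k * ((x + 1) ^ k - x ^ k) := by
  simp [polyA]

variable [Fintype F]

/-- If a prime l divides both numbers, an element u of order l has u^k = 1, and 1/(u - 1) is a
nonzero root of A_k besides 0. -/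
theorem coprime_of_isPermutationPolynomial_polyA {k : ℕ} (hk : 0 < k)
    (h : IsPermutationPolynomial (polyA F k)) : k.Coprime (Fintype.card F - 1) := by
  classical
  refine Nat.coprime_of_dvd fun l hl hlk hlQ => ?_
  have := Fact.mk hl
  rw [← Fintype.card_units] at hlQ
  obtain ⟨u, hu⟩ := exists_prime_orderOf_dvd_card l hlQ
  have huk : (u : F) ^ k = 1 := by
    obtain ⟨c, rfl⟩ := hlk
    rw [pow_mul, ← Units.val_pow_eq_pow_val, ← hu, pow_orderOf_eq_one, Units.val_one, one_pow]
  have hu1 : (u : F) - 1 ≠ 0 := by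
    intro h1
    have : u = 1 := Units.ext (by simpa using sub_eq_zero.mp h1)
    rw [this, orderOf_one] at hu
    exact hl.one_lt.ne hu
  have hx : ((u : F) - 1)⁻¹ + 1 = ((u : F) - 1)⁻¹ * u := by
    field_simp
    ring
  have heq : (polyA F k).eval ((u : F) - 1)⁻¹ = (polyA F k).eval 0 := by
    rw [polyA_eval, polyA_eval, hx, mul_pow, huk, mul_one, sub_self, mul_zero, zero_pow hk.ne',
      zero_mul]
  exact inv_ne_zero hu1 (h.injective heq)

/-- With y = (1+z)^m - 1 one has (1+y)^k = 1 + z, so A_k(1/y) = z / y^(2k). In the L-th power,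
y^(-2kL) equals y^(2t), because L ≡ -mt and km ≡ 1. -/
theorem sum_one_add_pow_sub_one_pow_mul_pow_eq_zero {k m t L : ℕ}
    (h : IsPermutationPolynomial (polyA F k)) (hk : 0 < k) (hm : 0 < m)
    (hkm : k * m ≡ 1 [MOD Fintype.card F - 1]) (hL : 0 < L)
    (hmt : ¬ Fintype.card F - 1 ∣ m * t) (hmtL : Fintype.card F - 1 ∣ m * t + L) :
    ∑ z : F, ((1 + z) ^ m - 1) ^ (2 * t) * z ^ L = 0 := by
  set Q := Fintype.card F - 1 with hQ
  have hpow (x : F) : (x ^ m) ^ k = x := by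
    rw [← pow_mul]
    simpa using FiniteField.pow_eq_pow_of_modEq x (Nat.mul_pos hm hk) one_pos
      (by rwa [mul_comm])
  have hinj : Function.Injective fun z : F => ((1 + z) ^ m - 1)⁻¹ := by
    intro x y hxy
    have h1 : (1 + x) ^ m = (1 + y) ^ m := sub_left_injective (inv_injective hxy)
    have h2 := congrArg (· ^ k) h1
    simpa [hpow] using h2
  have hbij : Function.Bijective fun z : F => ((1 + z) ^ m - 1)⁻¹ :=
    Finite.injective_iff_bijective.mp hinj
  have hQL : ¬ Q ∣ L := fun hd => hmt ((Nat.dvd_add_left hd).1 hmtL)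
  have h1 : ∑ x : F, ((polyA F k).eval x) ^ L = 0 := by
    have h2 := (Equiv.ofBijective _ h).sum_comp (fun y : F => y ^ L)
    rwa [FiniteField.sum_pow_eq_ite hL, if_neg hQL] at h2
  rw [← h1, ← (Equiv.ofBijective _ hbij).sum_comp (fun x : F => ((polyA F k).eval x) ^ L)]
  refine Finset.sum_congr rfl fun z _ => ?_
  simp only [Equiv.ofBijective_apply]
  rcases eq_or_ne z 0 with rfl | hz
  -- At z = 0 the convention 0⁻¹ = 0 keeps the substitution bijective, and both summands vanish.
  · simp [polyA_eval, hk.ne', hL.ne']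
  have hy : (1 + z) ^ m - 1 ≠ 0 := by
    intro hy0
    refine hz (hinj ?_)
    simp [hy0]
  set y := (1 + z) ^ m - 1 with hydef
  have hyk : (1 + y) ^ k = 1 + z := by rw [hydef, add_sub_cancel, hpow]
  have hA : (polyA F k).eval y⁻¹ = (y ^ (2 * k))⁻¹ * z := by
    have hy1 : y⁻¹ + 1 = y⁻¹ * (1 + y) := by field_simp
    rw [polyA_eval, hy1, mul_pow, hyk, inv_pow]
    field_simp
    ring
  have hyL : y ^ (2 * t) * (y ^ (2 * k)) ^ L = 1 := by
    rw [← pow_mul, ← pow_add]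
    have hdvd : Q ∣ 2 * t + 2 * k * L := by
      refine (Nat.modEq_zero_iff_dvd).1 ?_
      calc 2 * t + 2 * k * L = 2 * 1 * t + 2 * k * L := by ring
        _ ≡ 2 * (k * m) * t + 2 * k * L [MOD Q] :=
          ((hkm.symm.mul_left 2).mul_right t).add_right _
        _ = 2 * k * (m * t + L) := by ring
        _ ≡ 0 [MOD Q] := (Nat.modEq_zero_iff_dvd).2 (hmtL.mul_left _)
    obtain ⟨c, hc⟩ := hdvd
    rw [hc, pow_mul, FiniteField.pow_card_sub_one_eq_one y hy, one_pow]
  rw [hA, mul_pow, inv_pow, eq_inv_of_mul_eq_one_left hyL]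

end PolyA

/-- If `polyA F k` is a permutation polynomial, the middle term of the expansion of the power sum
attached to `a + b * p ^ j` cannot be the only one that does not vanish. -/
theorem exists_not_dvd_choose_cyclicRep {F : Type*} [Field F] [Fintype F] {p : ℕ}
    [hp : Fact p.Prime] [CharP F p] {k m a b j : ℕ}
    (h : IsPermutationPolynomial (polyA F k)) (hk : 0 < k) (hm : 0 < m)
    (hkm : k * m ≡ 1 [MOD Fintype.card F - 1]) (ha : 2 * a < p) (hb : 2 * b < p)
    (hab : ¬ Fintype.card F - 1 ∣ m * (a + p ^ j * b)) :
    ∃ i₀ ≤ 2 * a, ∃ i₁ ≤ 2 * b, (i₀, i₁) ≠ (a, b) ∧ 0 < i₀ + p ^ j * i₁ ∧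
      ¬ p ∣ (cyclicRep (Fintype.card F - 1) (m * (i₀ + p ^ j * i₁))).choose
        (cyclicRep (Fintype.card F - 1) (m * (a + p ^ j * b))) := by
  have hQ := FiniteField.card_sub_one_pos (F := F)
  by_contra! hcon
  set Q := Fintype.card F - 1 with hQdef
  set t := a + p ^ j * b with ht
  have hmt : 0 < m * t := Nat.pos_of_ne_zero fun h0 => hab (h0 ▸ dvd_zero _)
  obtain ⟨L, hL, hmtL⟩ : ∃ L, 0 < L ∧ Q ∣ m * t + L := by
    have h1 : m * t ≤ Q * (m * t) := Nat.le_mul_of_pos_left _ hQ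
    -- The extra Q guarantees L > 0.
    refine ⟨Q * (m * t) - m * t + Q, by lia, ?_⟩
    rw [← add_assoc, Nat.add_sub_cancel' h1]
    exact (dvd_mul_right _ _).add dvd_rfl
  have hQL : ¬ Q ∣ L := fun hd => hab ((Nat.dvd_add_left hd).1 hmtL)
  have hsum := sum_one_add_pow_sub_one_pow_mul_pow_eq_zero h hk hm hkm hL hab hmtL
  have hexp (z : F) : ((1 + z) ^ m - 1) ^ (2 * t) * z ^ L =
      ∑ i₀ ∈ Finset.range (2 * a + 1), ∑ i₁ ∈ Finset.range (2 * b + 1),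
        ((-1) ^ (2 * a - i₀) * (2 * a).choose i₀ * ((-1) ^ (2 * b - i₁) * (2 * b).choose i₁) : F) *
          ((1 + z) ^ (m * (i₀ + p ^ j * i₁)) * z ^ L) := by
    have h1 : ((1 + z) ^ m - 1) ^ (2 * t) =
        ((1 + z) ^ m + -1) ^ (2 * a) * ((1 + z) ^ (m * p ^ j) + -1) ^ (2 * b) := by
      rw [ht, mul_add, pow_add, ← sub_eq_add_neg, ← sub_eq_add_neg, pow_mul (1 + z) m,
        ← one_pow (p ^ j), ← sub_pow_char_pow, one_pow, ← pow_mul]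
      congr 2
      ring
    rw [h1, add_pow ((1 + z) ^ m), add_pow ((1 + z) ^ (m * p ^ j)), Finset.sum_mul_sum, Finset.sum_mul]
    refine Finset.sum_congr rfl fun i₀ _ => ?_
    rw [Finset.sum_mul]
    refine Finset.sum_congr rfl fun i₁ _ => ?_
    rw [mul_add m, pow_add, pow_mul, ← mul_assoc m, pow_mul _ (m * p ^ j)]
    ring
  simp_rw [hexp] at hsum
  rw [Finset.sum_comm] at hsum
  have hswap : ∀ i₀ ∈ Finset.range (2 * a + 1), (∑ z : F, ∑ i₁ ∈ Finset.range (2 * b + 1),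
        ((-1) ^ (2 * a - i₀) * (2 * a).choose i₀ * ((-1) ^ (2 * b - i₁) * (2 * b).choose i₁) : F) *
          ((1 + z) ^ (m * (i₀ + p ^ j * i₁)) * z ^ L)) =
      ∑ i₁ ∈ Finset.range (2 * b + 1), if i₀ = a ∧ i₁ = b then
        -((-1) ^ a * (2 * a).choose a * ((-1) ^ b * (2 * b).choose b) : F) else 0 := by
    intro i₀ hi₀
    rw [Finset.sum_comm]
    refine Finset.sum_congr rfl fun i₁ hi₁ => ?_
    rw [← Finset.mul_sum]
    rw [Finset.mem_range, Nat.lt_succ_iff] at hi₀ hi₁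
    split_ifs with heq
    · obtain ⟨rfl, rfl⟩ := heq
      rw [sum_one_add_pow_mul_pow hmt hL hab hmtL, Nat.choose_self, Nat.cast_one, mul_neg_one,
        two_mul, Nat.add_sub_cancel, two_mul, Nat.add_sub_cancel]
    -- Exponent 0 cannot be replaced by its representative Q, since 0^0 ≠ 0^Q; that term is a plain
    -- power sum of z^L.
    · rcases Nat.eq_zero_or_pos (i₀ + p ^ j * i₁) with h0 | h0
      · simp only [h0, mul_zero, pow_zero, one_mul]
        rw [FiniteField.sum_pow_eq_ite hL, if_neg hQL, mul_zero]
      · have hd := hcon i₀ hi₀ i₁ hi₁ (by simpa using heq) h0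
        rw [sum_one_add_pow_mul_pow (Nat.mul_pos hm h0) hL hab hmtL,
          (CharP.cast_eq_zero_iff F p _).2 hd, neg_zero, mul_zero]
  rw [Finset.sum_congr rfl hswap] at hsum
  have hchoose {c : ℕ} (hc : 2 * c < p) : (((2 * c).choose c : ℕ) : F) ≠ 0 := by
    rw [Ne, CharP.cast_eq_zero_iff F p]
    intro hd
    have hfac := Nat.choose_mul_factorial_mul_factorial (show c ≤ 2 * c by lia)
    have : p ∣ (2 * c).factorial := hfac ▸ (hd.mul_right _).mul_right _
    exact absurd ((hp.out.dvd_factorial).1 this) (not_le.2 hc)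
  rw [Finset.sum_eq_single a, Finset.sum_eq_single b, if_pos ⟨rfl, rfl⟩] at hsum
  · have h1 : ((-1 : F) ^ a) ≠ 0 := pow_ne_zero _ (by simp)
    have h2 : ((-1 : F) ^ b) ≠ 0 := pow_ne_zero _ (by simp)
    exact neg_ne_zero.2 (mul_ne_zero (mul_ne_zero h1 (hchoose ha)) (mul_ne_zero h2 (hchoose hb)))
      hsum
  · intro i _ hi
    rw [if_neg (by tauto)]
  · intro hb'
    exact absurd (Finset.mem_range.2 (by lia)) hb'
  · intro i _ hi
    exact Finset.sum_eq_zero fun i' _ => if_neg (by tauto)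
  · intro ha'
    exact absurd (Finset.mem_range.2 (by lia)) ha'

/-! ### Multiples of m of maximal weight -/

section Weights

variable {p e : ℕ} [hp : Fact p.Prime]

theorem cyclicWeight_mul_add_le (he : 0 < e) (m j : ℕ) {u v : ℕ} (huv : 0 < u + v) :
    cyclicWeight p e (m * (u + p ^ j * v)) ≤ (u + v) * cyclicWeight p e m := by
  have h1 {u : ℕ} (hu : 0 < u) : cyclicWeight p e (m * u) ≤ u * cyclicWeight p e m := by
    rw [mul_comm m]
    exact cyclicWeight_mul_le he hu m
  have h2 {v : ℕ} (hv : 0 < v) : cyclicWeight p e (m * (p ^ j * v)) ≤ v * cyclicWeight p e m := by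
    rw [mul_left_comm]
    exact (cyclicWeight_pow_mul_le he j _).trans (h1 hv)
  rcases Nat.eq_zero_or_pos u with rfl | hu
  · simpa using h2 (by simpa using huv)
  rcases Nat.eq_zero_or_pos v with rfl | hv
  · simpa using h1 hu
  rw [mul_add, add_mul]
  exact (cyclicWeight_add_le he _ _).trans (Nat.add_le_add (h1 hu) (h2 hv))

/-- Maximality fails at the multiplier p, since w(pm) ≤ w(m) < p w(m); n + 1 is the first failure.
-/
theorem exists_mul_eq_max (he : 0 < e) (m : ℕ) (hp2 : 2 ≤ p) :
    ∃ n, 0 < n ∧ cyclicWeight p e (m * n) = n * cyclicWeight p e m ∧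
      cyclicWeight p e (m * (n + 1)) < (n + 1) * cyclicWeight p e m := by
  classical
  have hex : ∃ n, cyclicWeight p e (m * (n + 1)) < (n + 1) * cyclicWeight p e m := by
    refine ⟨p - 1, ?_⟩
    rw [Nat.sub_add_cancel (by lia), mul_comm m]
    have h1 := cyclicWeight_pow_mul_le (p := p) he 1 m
    rw [pow_one] at h1
    have h2 := cyclicWeight_pos (p := p) he m
    nlinarith
  have hpos : 0 < Nat.find hex := by
    refine Nat.pos_of_ne_zero fun h0 => ?_
    have := Nat.find_spec hex
    rw [h0] at this
    simp at this
  refine ⟨Nat.find hex, hpos, le_antisymm ?_ ?_, Nat.find_spec hex⟩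
  · rw [mul_comm m]
    exact cyclicWeight_mul_le he hpos m
  · have := Nat.find_min hex (Nat.sub_lt hpos one_pos)
    rw [show Nat.find hex - 1 + 1 = Nat.find hex from Nat.sub_add_cancel hpos] at this
    exact not_lt.mp this

end Weights

/-! ### Digits of m are at most one -/

section PermutationPolynomial

variable {F : Type*} [Field F] [Fintype F] {p e k m : ℕ} [hp : Fact p.Prime] [CharP F p]

/-- The indices (i₀, i₁) and (2a - i₀, 2b - i₁) average to (a, b). Kummer's theorem gives 2w(mt) ≤
w(ms) + (2a + 2b - i₀ - i₁) w(m), so maximality at t passes to s. -/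
theorem exists_le_cyclicWeight_mul (hF : Fintype.card F = p ^ e) (he : 0 < e)
    (h : IsPermutationPolynomial (polyA F k)) (hk : 0 < k) (hm : 0 < m)
    (hkm : k * m ≡ 1 [MOD p ^ e - 1]) {a b : ℕ} (j : ℕ) (ha : 2 * a < p) (hb : 2 * b < p)
    (hab0 : 0 < a + p ^ j * b) (habQ : a + p ^ j * b < p ^ e - 1)
    (hinj : ∀ i₀ ≤ 2 * a, ∀ i₁ ≤ 2 * b, i₀ + p ^ j * i₁ = a + p ^ j * b → (i₀, i₁) = (a, b))
    (hw : cyclicWeight p e (m * (a + p ^ j * b)) = (a + b) * cyclicWeight p e m) :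
    ∃ i₀ ≤ 2 * a, ∃ i₁ ≤ 2 * b, (i₀, i₁) ≠ (a, b) ∧ a + b ≤ i₀ + i₁ ∧
      cyclicWeight p e (m * (i₀ + p ^ j * i₁)) = (i₀ + i₁) * cyclicWeight p e m ∧
      ¬ p ∣ (cyclicRep (p ^ e - 1) (m * (i₀ + p ^ j * i₁))).choose
        (cyclicRep (p ^ e - 1) (m * (a + p ^ j * b))) := by
  have hcop : (p ^ e - 1).gcd m = 1 := by
    have h1 : Nat.gcd (k * m) (p ^ e - 1) = 1 := by rw [hkm.gcd_eq, Nat.gcd_one_left]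
    exact (Nat.Coprime.coprime_mul_left h1).symm
  have hab : ¬ p ^ e - 1 ∣ m * (a + p ^ j * b) := fun hd =>
    not_le.2 habQ (Nat.le_of_dvd hab0 (Nat.Coprime.dvd_of_dvd_mul_left hcop hd))
  rw [← hF] at hkm hab
  obtain ⟨i₀, hi₀, i₁, hi₁, hne, h0, hc⟩ :=
    exists_not_dvd_choose_cyclicRep h hk hm hkm ha hb hab
  rw [hF] at hc
  have hnc : ¬ m * (i₀ + p ^ j * i₁) ≡ m * (a + p ^ j * b) [MOD p ^ e - 1] := by
    intro hmod
    have hmod' := Nat.ModEq.cancel_left_of_coprime hcop hmod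
    -- Both are positive combinations with 0 ≤ s ≤ 2t, so |s - t| ≤ t < Q and the congruence is an
    -- equality.
    refine hne (hinj i₀ hi₀ i₁ hi₁ (hmod'.eq_of_abs_lt ?_))
    have : p ^ j * i₁ ≤ 2 * (p ^ j * b) := by
      rw [mul_left_comm]
      exact Nat.mul_le_mul_left _ hi₁
    rw [abs_lt]
    constructor <;> push_cast <;> zify at * <;> linarith
  have hi : 0 < i₀ + i₁ := by
    refine Nat.pos_of_ne_zero fun h1 => ?_
    obtain ⟨rfl, rfl⟩ := Nat.add_eq_zero_iff.mp h1
    simp at h0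
  have hle := cyclicWeight_mul_add_le (p := p) he m j hi
  have hsum : m * (i₀ + p ^ j * i₁) + m * ((2 * a - i₀) + p ^ j * (2 * b - i₁)) ≡
      2 * (m * (a + p ^ j * b)) [MOD p ^ e - 1] := by
    rw [show m * (i₀ + p ^ j * i₁) + m * ((2 * a - i₀) + p ^ j * (2 * b - i₁)) =
      m * ((i₀ + (2 * a - i₀)) + p ^ j * (i₁ + (2 * b - i₁))) by ring,
      Nat.add_sub_cancel' hi₀, Nat.add_sub_cancel' hi₁,
      show 2 * (m * (a + p ^ j * b)) = m * (2 * a + p ^ j * (2 * b)) by ring]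
  have hD : m * ((2 * a - i₀) + p ^ j * (2 * b - i₁)) = 0 ∨
      cyclicWeight p e (m * ((2 * a - i₀) + p ^ j * (2 * b - i₁))) ≤
        ((2 * a - i₀) + (2 * b - i₁)) * cyclicWeight p e m := by
    rcases Nat.eq_zero_or_pos ((2 * a - i₀) + (2 * b - i₁)) with h1 | h1
    · left
      obtain ⟨h2, h3⟩ := Nat.add_eq_zero_iff.mp h1
      rw [h2, h3]
      simp
    · exact Or.inr (cyclicWeight_mul_add_le he m j h1)
  obtain ⟨hw1, hw2⟩ := cyclicWeight_le_of_not_dvd_choose he hc hnc hsum hD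
  have hwpos := cyclicWeight_pos (p := p) he m
  rw [hw] at hw1 hw2
  refine ⟨i₀, hi₀, i₁, hi₁, hne, Nat.le_of_mul_le_mul_right (hw1.trans hle) hwpos,
    le_antisymm hle ?_, hc⟩
  zify [hi₀, hi₁] at hw2 ⊢
  linarith

/-- Multiplication of `m` by some integer exceeding `p / 2` does not produce carries. -/
theorem exists_lt_two_mul_cyclicWeight_mul (hF : Fintype.card F = p ^ e) (he : 0 < e)
    (hp2 : 2 < p) (h : IsPermutationPolynomial (polyA F k)) (hk : 0 < k) (hm : 0 < m)
    (hkm : k * m ≡ 1 [MOD p ^ e - 1]) :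
    ∃ n, p < 2 * n ∧ cyclicWeight p e (m * n) = n * cyclicWeight p e m := by
  obtain ⟨n, hn, hn1, hn2⟩ := exists_mul_eq_max (p := p) he m hp2.le
  have hpQ : p ≤ p ^ e := Nat.le_self_pow he.ne' p
  refine ⟨n, ?_, hn1⟩
  by_contra hle
  have hodd := hp.out.eq_two_or_odd
  have hnp : 2 * n < p := by lia
  obtain ⟨i₀, hi₀, i₁, hi₁, hne, hge, hw, -⟩ := exists_le_cyclicWeight_mul (a := n) (b := 0)
    hF he h hk hm hkm 0 hnp (by simpa using hp.out.pos) (by simpa using hn) (by lia)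
    (by intro i₀ _ i₁ hi₁; simp_all) (by simpa using hn1)
  obtain rfl : i₁ = 0 := by simpa using hi₁
  simp only [add_zero, mul_zero] at hge hw hne
  have hgt : n < i₀ := lt_of_le_of_ne hge fun h => hne (by rw [h])
  -- By subadditivity, maximality at i₀ > n descends to n + 1, where it fails.
  rcases Nat.eq_zero_or_pos (i₀ - (n + 1)) with h0 | h0
  · obtain rfl : i₀ = n + 1 := by lia
    exact hn2.ne hw
  · have h1 := cyclicWeight_add_le (p := p) he (m * (n + 1)) ((i₀ - (n + 1)) * m)
    have h2 := cyclicWeight_mul_le (p := p) he h0 m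
    rw [mul_comm _ m, ← mul_add, Nat.add_sub_cancel' hgt, hw] at h1
    rw [mul_comm _ m] at h2
    zify [show n + 1 ≤ i₀ from hgt] at *
    linarith

/-- All the base-`p` digits of the inverse of `k` modulo `p ^ e - 1` are at most one. -/
theorem digit_le_one (hF : Fintype.card F = p ^ e) (he : 0 < e)
    (hp2 : 2 < p) (h : IsPermutationPolynomial (polyA F k)) (hk : 0 < k) (hm : 0 < m)
    (hmQ : m ≤ p ^ e - 1) (hkm : k * m ≡ 1 [MOD p ^ e - 1]) {d : Fin e → ℕ} (hd : ∀ i, d i < p)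
    (hdm : digitVal p d = m) (i : Fin e) : d i ≤ 1 := by
  obtain ⟨n, hn, hw⟩ := exists_lt_two_mul_cyclicWeight_mul hF he hp2 h hk hm hkm
  by_contra hi
  have hni : p ≤ n * d i := hn.le.trans (by rw [mul_comm 2]; exact Nat.mul_le_mul_left n (by lia))
  have h1 := digitSum_digitVal_lt (p := p) (fun i => n * d i) hni
  have h2 : digitVal p (fun i => n * d i) = m * n := by
    rw [← hdm, digitVal, digitVal, Finset.sum_mul]
    exact Finset.sum_congr rfl fun i _ => by ring
  have h3 : cyclicWeight p e m = ∑ i, d i := by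
    rw [cyclicWeight, cyclicRep_eq_self hm hmQ, ← hdm, digitSum_digitVal d hd]
  have h4 := cyclicWeight_le_digitSum (p := p) he (Nat.mul_pos hm (show 0 < n by lia))
  rw [h2, ← Finset.mul_sum, ← h3] at h1
  lia

end PermutationPolynomial

/-! ### Only one digit of m is nonzero -/

section PermutationPolynomial

variable {F : Type*} [Field F] [Fintype F] {p k m n : ℕ} [hp : Fact p.Prime] [CharP F p]

theorem digitVal_mul_add_shift_modEq (d : Fin (n + 1) → ℕ) (j : Fin (n + 1)) (u v : ℕ) :
    digitVal p (fun i => u * d i + v * d (i - j)) ≡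
      digitVal p d * (u + p ^ (j : ℕ) * v) [MOD p ^ (n + 1) - 1] := by
  have h1 : digitVal p (fun i => u * d i + v * d (i - j)) =
      u * digitVal p d + v * digitVal p (fun i => d (i - j)) := by
    simp only [digitVal, Finset.mul_sum, ← Finset.sum_add_distrib]
    exact Finset.sum_congr rfl fun i _ => by ring
  rw [h1, show digitVal p d * (u + p ^ (j : ℕ) * v) =
    u * digitVal p d + v * (p ^ (j : ℕ) * digitVal p d) by ring]
  exact ((digitVal_shift_modEq d j).mul_left v).add_left _

theorem sum_mul_add_shift (d : Fin (n + 1) → ℕ) (j : Fin (n + 1)) (u v : ℕ) :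
    ∑ i, (u * d i + v * d (i - j)) = (u + v) * ∑ i, d i := by
  rw [Finset.sum_add_distrib, ← Finset.mul_sum, ← Finset.mul_sum, add_mul]
  congr 2
  exact (Equiv.subRight j).sum_comp d

/-- Two distinct digits of the inverse of `k` cannot both be equal to one. -/
theorem eq_of_digit_eq_one (hF : Fintype.card F = p ^ (n + 1)) (hp2 : 2 < p)
    (h : IsPermutationPolynomial (polyA F k)) (hk : 0 < k) (hm : 0 < m)
    (hmQ : m ≤ p ^ (n + 1) - 1) (hkm : k * m ≡ 1 [MOD p ^ (n + 1) - 1]) {d : Fin (n + 1) → ℕ}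
    (hd : ∀ i, d i ≤ 1) (hdm : digitVal p d = m) {a b : Fin (n + 1)} (ha : d a = 1)
    (hb : d b = 1) : a = b := by
  by_contra hab
  set Q := p ^ (n + 1) - 1 with hQ
  set j := a - b with hj
  have hj0 : (j : ℕ) ≠ 0 := fun h0 => hab (sub_eq_zero.1 (Fin.ext h0))
  set P := p ^ (j : ℕ) with hP
  -- r = (p-1)/2 is the largest value for which r + r produces no carry on digits 0 and 1.
  obtain ⟨r, hr⟩ : ∃ r, p = 2 * r + 1 := hp.out.odd_of_ne_two (by lia)
  have hpP : p ≤ P := Nat.le_self_pow hj0 p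
  have hPQ : p * P ≤ Q + 1 := by
    rw [hQ, Nat.sub_add_cancel (Nat.one_le_pow _ _ hp.out.pos), hP, ← pow_succ']
    exact Nat.pow_le_pow_right hp.out.pos j.isLt
  have hcop : Q.gcd m = 1 := by
    have h1 : Nat.gcd (k * m) Q = 1 := by rw [hkm.gcd_eq, Nat.gcd_one_left]
    exact (Nat.Coprime.coprime_mul_left h1).symm
  have hwm : cyclicWeight p (n + 1) m = ∑ i, d i := by
    rw [cyclicWeight, cyclicRep_eq_self hm hmQ, ← hdm,
      digitSum_digitVal d fun i => (hd i).trans_lt hp.out.one_lt]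
  have hpos {u v : ℕ} (huv : 0 < u + v) : 0 < digitVal p (fun i => u * d i + v * d (i - j)) := by
    have hja : a - j = b := by rw [hj, sub_sub_cancel]
    refine Finset.sum_pos' (fun i _ => Nat.zero_le _) ⟨a, Finset.mem_univ a, ?_⟩
    dsimp only
    rw [ha, hja, hb, mul_one, mul_one]
    exact Nat.mul_pos huv (pow_pos hp.out.pos _)
  have hlt {u v : ℕ} (huv : u + v < p) (i : Fin (n + 1)) : u * d i + v * d (i - j) < p := by
    have h1 := Nat.mul_le_mul_left u (hd i)
    have h2 := Nat.mul_le_mul_left v (hd (i - j))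
    lia
  have hrep {u v : ℕ} (huv : 0 < u + v) (huvp : u + v < p) :
      cyclicRep Q (m * (u + P * v)) = digitVal p (fun i => u * d i + v * d (i - j)) := by
    rw [← hdm, ← cyclicRep_congr (digitVal_mul_add_shift_modEq d j u v),
      cyclicRep_eq_self (hpos huv)]
    exact Nat.le_sub_one_of_lt (digitVal_lt _ (hlt huvp))
  have hw : cyclicWeight p (n + 1) (m * (r + P * r)) =
      (r + r) * cyclicWeight p (n + 1) m := by
    rw [cyclicWeight, hrep (by lia) (by lia), digitSum_digitVal _ (hlt (by lia)),
      sum_mul_add_shift, hwm]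
  have htQ : r + P * r < Q := by
    rw [hr] at hPQ hpP
    nlinarith
  obtain ⟨i₀, hi₀, i₁, hi₁, hne, hge, hwi, hc⟩ := exists_le_cyclicWeight_mul (a := r) (b := r)
    hF n.succ_pos h hk hm hkm j (by lia) (by lia) (by lia) htQ (by
      -- Since i₀ ≤ 2r < p ≤ P, reduction mod P recovers i₀.
      intro i₀ hi₀ i₁ hi₁ heq
      have h1 : i₀ = r := by
        have h2 := congrArg (· % P) heq
        simpa [← hP, Nat.mod_eq_of_lt (show i₀ < P by lia),
          Nat.mod_eq_of_lt (show r < P by lia)] using h2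
      subst h1
      rw [Prod.mk.injEq]
      exact ⟨rfl, Nat.eq_of_mul_eq_mul_left (show 0 < P by lia) (Nat.add_left_cancel heq)⟩) hw
  -- At position a both m and its shift have digit 1, so i₀ + i₁ ≥ p would carry there and
  -- contradict maximal weight. Hence i₀ + i₁ = 2r.
  have hsum : i₀ + i₁ < p := by
    by_contra hge'
    have hca : p ≤ i₀ * d a + i₁ * d (a - j) := by
      rw [hj, sub_sub_cancel, ha, hb]
      lia
    have h1 := digitSum_digitVal_lt (p := p) (fun i => i₀ * d i + i₁ * d (i - j)) hca
    have h2 := cyclicWeight_le_digitSum (p := p) n.succ_pos (hpos (u := i₀) (v := i₁) (by lia))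
    rw [cyclicWeight_congr (digitVal_mul_add_shift_modEq d j i₀ i₁), hdm, hwi, hwm] at h2
    rw [sum_mul_add_shift] at h1
    lia
  rw [← hQ, ← hP, hrep (by lia) hsum, hrep (by lia) (by lia)] at hc
  have hdig := le_of_not_dvd_choose_digitVal (p := p) _ _ (hlt hsum) (hlt (by lia)) hc
  have hshift : ∑ i, d (i - j) = ∑ i, d i := (Equiv.subRight j).sum_comp d
  -- As (i₀, i₁) ≠ (r, r), one index is below r. Lucas' digitwise inequality then gives domination
  -- between d and its shift, and equal sums force equality.
  have hper : ∀ i, d (i - j) = d i := by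
    rcases lt_or_ge i₀ r with hlt₀ | hge₀
    · have hle (i) : d i ≤ d (i - j) := by
        have h1 := hdig i
        have h2 := hd i
        have h3 := hd (i - j)
        by_contra hcon
        have h4 : d i = 1 := by lia
        have h5 : d (i - j) = 0 := by lia
        simp only [h4, h5] at h1
        lia
      exact fun i => ((Finset.sum_eq_sum_iff_of_le fun i _ => hle i).1 hshift.symm i
        (Finset.mem_univ i)).symm
    · have hlt₁ : i₁ < r := by
        rcases hge₀.eq_or_lt with h1 | h1
        · subst h1
          exact lt_of_le_of_ne (by lia) fun h2 => hne (by rw [h2])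
        · lia
      have hle (i) : d (i - j) ≤ d i := by
        have h1 := hdig i
        have h2 := hd i
        have h3 := hd (i - j)
        by_contra hcon
        have h4 : d (i - j) = 1 := by lia
        have h5 : d i = 0 := by lia
        simp only [h4, h5] at h1
        lia
      exact fun i => (Finset.sum_eq_sum_iff_of_le fun i _ => hle i).1 hshift i
        (Finset.mem_univ i)
  have hmod : m * P ≡ m * 1 [MOD Q] := by
    have h1 := digitVal_shift_modEq (p := p) d j
    simp only [hper] at h1
    rw [hdm, ← hP, ← hQ] at h1
    rw [mul_one, mul_comm]
    exact h1.symm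
  have hmod' := Nat.ModEq.cancel_left_of_coprime hcop hmod
  have : P = 1 := by
    refine hmod'.eq_of_abs_lt ?_
    have h3 : P < Q + 1 := lt_of_lt_of_le (by nlinarith) hPQ
    rw [abs_lt]
    constructor <;> push_cast <;> lia
  lia

theorem exists_eq_pow_of_isPermutationPolynomial_polyA (hF : Fintype.card F = p ^ (n + 1))
    (hp2 : 2 < p) (hk : 0 < k) (hkQ : k ≤ p ^ (n + 1) - 1)
    (h : IsPermutationPolynomial (polyA F k)) : ∃ i, k = p ^ i := by
  set Q := p ^ (n + 1) - 1 with hQ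
  have hpQ : p ≤ p ^ (n + 1) := Nat.le_self_pow n.succ_ne_zero p
  have hcop := coprime_of_isPermutationPolynomial_polyA hk h
  rw [hF, ← hQ] at hcop
  obtain ⟨m, hmQ, hkm'⟩ := Nat.exists_mul_mod_eq_one_of_coprime hcop (by lia)
  have hkm : k * m ≡ 1 [MOD Q] := by
    rw [Nat.ModEq, hkm', Nat.mod_eq_of_lt (by lia)]
  have hm : 0 < m := by
    refine Nat.pos_of_ne_zero ?_
    rintro rfl
    simp at hkm'
  obtain ⟨d, hd, hdm⟩ := exists_digitVal_eq (p := p) (n + 1) (x := m) (by lia)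
  have hd1 := digit_le_one hF n.succ_pos hp2 h hk hm hmQ.le hkm hd hdm
  obtain ⟨a, ha⟩ : ∃ a, d a = 1 := by
    by_contra! hcon
    have h0 : ∀ i, d i = 0 := fun i => by
      have := hd1 i
      have := hcon i
      lia
    exact hm.ne' (by rw [← hdm]; simp [digitVal, h0])
  have hma : m = p ^ (a : ℕ) := by
    rw [← hdm, digitVal, Finset.sum_eq_single a, ha, one_mul]
    · intro i _ hi
      have h1 : d i ≠ 1 := fun h1 =>
        hi (eq_of_digit_eq_one hF hp2 h hk hm hmQ.le hkm hd1 hdm h1 ha)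
      have h2 := hd1 i
      rw [show d i = 0 by lia, zero_mul]
    · exact fun h1 => absurd (Finset.mem_univ a) h1
  have hmod : k ≡ p ^ (n + 1 - a) [MOD Q] := by
    have hone : p ^ (n + 1) ≡ 1 [MOD Q] :=
      ((Nat.modEq_iff_dvd' (Nat.one_le_pow _ _ hp.out.pos)).2 dvd_rfl).symm
    have h1 := hkm.mul_right (p ^ (n + 1 - a))
    rw [hma, mul_assoc, ← pow_add, Nat.add_sub_cancel' a.isLt.le, one_mul] at h1
    simpa using (hone.mul_left k).symm.trans h1
  have hrep := cyclicRep_congr hmod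
  rw [cyclicRep_eq_self hk hkQ] at hrep
  -- For a = 0 the power p^(n+1) exceeds Q, and its representative is p^0.
  rcases Nat.eq_zero_or_pos (a : ℕ) with h0 | h0
  · refine ⟨0, ?_⟩
    have h1 : k ≡ 1 [MOD Q] := by simpa [hma, h0] using hkm
    have h2 := cyclicRep_congr h1
    rwa [cyclicRep_eq_self hk hkQ, cyclicRep_eq_self one_pos (by lia)] at h2
  · refine ⟨n + 1 - a, ?_⟩
    rwa [cyclicRep_eq_self (pow_pos hp.out.pos _)] at hrep
    exact Nat.le_sub_one_of_lt (Nat.pow_lt_pow_right hp.out.one_lt (by lia))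

theorem isPermutationPolynomial_polyA_pow (i : ℕ) :
    IsPermutationPolynomial (polyA F (p ^ i)) := by
  refine Finite.injective_iff_bijective.mp fun x y hxy => ?_
  simp only [polyA_eval, add_pow_char_pow, one_pow, add_sub_cancel_left, mul_one] at hxy
  rw [← sub_eq_zero, ← sub_pow_char_pow] at hxy
  exact sub_eq_zero.1 (eq_zero_of_pow_eq_zero hxy)

end PermutationPolynomial

theorem mainTheorem1 (p e q : ℕ) (hp : p.Prime) (hp_odd : Odd p) (he : 0 < e) (hq : q = p ^ e)
    (F : Type*) [Field F] [Fintype F] (hF : Fintype.card F = q)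
    (k : ℕ) (hk_one : 1 ≤ k) (hk_le : k ≤ q - 1) :
    IsPermutationPolynomial (polyA F k) ↔ ∃ i : ℕ, k = p ^ i := by
  subst hq
  have := Fact.mk hp
  have : CharP F p := charP_of_card_eq_prime_pow hF
  obtain ⟨n, rfl⟩ := Nat.exists_eq_add_one_of_ne_zero he.ne'
  constructor
  · refine exists_eq_pow_of_isPermutationPolynomial_polyA hF ?_ hk_one hk_le
    obtain ⟨r, hr⟩ := hp_odd
    have := hp.two_le
    lia
  · rintro ⟨i, rfl⟩
    exact isPermutationPolynomial_polyA_pow i
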